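/- Let $U\subset\mathbb{R}^n$ be open and let $g:U\to\mathbb{R}^n\setminus\{0\}$ be locally Lipschitz, i.e. Lipschitz on every compact subset of $U$. A function $u:V\to\mathbb{R}$ is called a normal solution to the total differential equation $\nabla u(x)=\lambda(x)g(x)$ if (1) $V$ is open and $V\subset U$; (2) $u$ is locally Lipschitz (Lipschitz on every compact subset of $V$); (3) every level set $u^{-1}(c)$, $c\in\mathbb{R}$, is an $(n-1)$-dimensional $C^1$ (embedded) submanifold of $\mathbb{R}^n$ (possibly empty); (4) $g$ is a normal vector field of every level set, i.e. $g(x)\cdot v=0$ for every $x\in u^{-1}(c)$ and every $v$ in the tangent space $T_x(u^{-1}(c))$; (5) $u$ has no local maximum point and no local minimum point in $V$; and (6) $\nabla u(x)\neq 0$ at every $x\in V$ at which $u$ is differentiable. Let $u_1:V_1\to\mathbb{R}$ and $u_2:V_2\to\mathbb{R}$ be two normal solutions and let $x^*\in V_1\cap V_2$. Then there exists an open neighborhood $V_3\subset V_1\cap V_2$ of $x^*$ such that $u_2$ is a monotone transform of $u_1$ on $V_3$, i.e. there is a function $\varphi:u_1(V_3)\to\mathbb{R}$ which is either strictly increasing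 or strictly decreasing and satisfies $u_2(x)=\varphi(u_1(x))$ for all $x\in V_3$. In particular, for the same $V_3$, $$u_1^{-1}(u_1(x^*))\cap V_3=u_2^{-1}(u_2(x^*))\cap V_3 .$$ -/

import Mathlib

open Set

/-- `f` is Lipschitz on every compact subset of `U`. -/
def LipschitzOnCompacts {m n : ℕ}
    (f : EuclideanSpace ℝ (Fin n) → EuclideanSpace ℝ (Fin m))
    (U : Set (EuclideanSpace ℝ (Fin n))) : Prop :=
  ∀ C : Set (EuclideanSpace ℝ (Fin n)), C ⊆ U → IsCompact C → ∃ L, LipschitzOnWith L f C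

/-- The same notion for real-valued functions. -/
def RealLipschitzOnCompacts {n : ℕ} (f : EuclideanSpace ℝ (Fin n) → ℝ)
    (U : Set (EuclideanSpace ℝ (Fin n))) : Prop :=
  ∀ C : Set (EuclideanSpace ℝ (Fin n)), C ⊆ U → IsCompact C → ∃ L, LipschitzOnWith L f C

/-- `f` is `C^k` on an arbitrary subset `X` of `ℝ^N`: around every point of `X` the restriction of
`f` to `X` extends to a `C^k` map defined on a ball of `ℝ^N`. -/
def IsCkOn {N M : ℕ} (k : ℕ∞) (f : EuclideanSpace ℝ (Fin N) → EuclideanSpace ℝ (Fin M))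
    (X : Set (EuclideanSpace ℝ (Fin N))) : Prop :=
  ∀ x ∈ X, ∃ r > 0, ∃ F : EuclideanSpace ℝ (Fin N) → EuclideanSpace ℝ (Fin M),
    ContDiffOn ℝ k F (Metric.ball x r) ∧ ∀ y ∈ X ∩ Metric.ball x r, F y = f y

/-- `f` restricts to a `C^k` diffeomorphism from `X` onto `Y`. -/
def IsCkDiffeoOn {N M : ℕ} (k : ℕ∞) (f : EuclideanSpace ℝ (Fin N) → EuclideanSpace ℝ (Fin M))
    (X : Set (EuclideanSpace ℝ (Fin N))) (Y : Set (EuclideanSpace ℝ (Fin M))) : Prop :=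
  BijOn f X Y ∧ IsCkOn k f X ∧ ∃ f' : EuclideanSpace ℝ (Fin M) → EuclideanSpace ℝ (Fin N),
    InvOn f' f X Y ∧ IsCkOn k f' Y

/-- `φ`, defined on the open set `W ⊆ ℝ^d`, is a local parametrization of `X` around `x`:
a `C^k` diffeomorphism from `W` onto a relatively open neighborhood of `x` in `X`. -/
def IsLocalParametrization {d N : ℕ} (k : ℕ∞) (X : Set (EuclideanSpace ℝ (Fin N)))
    (x : EuclideanSpace ℝ (Fin N)) (W : Set (EuclideanSpace ℝ (Fin d)))
    (φ : EuclideanSpace ℝ (Fin d) → EuclideanSpace ℝ (Fin N)) : Prop :=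
  IsOpen W ∧ ∃ O : Set (EuclideanSpace ℝ (Fin N)), IsOpen O ∧ x ∈ X ∩ O ∧
    IsCkDiffeoOn k φ W (X ∩ O)

/-- `X ⊆ ℝ^N` is a `d`-dimensional `C^k` manifold. -/
def IsCkManifold {N : ℕ} (d : ℕ) (k : ℕ∞) (X : Set (EuclideanSpace ℝ (Fin N))) : Prop :=
  ∀ x ∈ X, ∃ (W : Set (EuclideanSpace ℝ (Fin d)))
    (φ : EuclideanSpace ℝ (Fin d) → EuclideanSpace ℝ (Fin N)), IsLocalParametrization k X x W φ

/-- The tangent space at `x` of a `d`-dimensional `C^1` manifold `X ⊆ ℝ^N`: the range of `Dφ(w)`,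
where `φ` is a local parametrization around `x` with `φ(w) = x`. For a manifold this range is the
same for every such `φ`. -/
def tangentSet {N : ℕ} (d : ℕ) (X : Set (EuclideanSpace ℝ (Fin N)))
    (x : EuclideanSpace ℝ (Fin N)) : Set (EuclideanSpace ℝ (Fin N)) :=
  {v | ∃ (W : Set (EuclideanSpace ℝ (Fin d)))
    (φ : EuclideanSpace ℝ (Fin d) → EuclideanSpace ℝ (Fin N)), IsLocalParametrization 1 X x W φ ∧
      ∃ w ∈ W, φ w = x ∧ v ∈ range (fderiv ℝ φ w)}

/-- `g` is a normal vector field of the `d`-dimensional `C^1` manifold `X`. -/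
def IsNormalField {N : ℕ} (d : ℕ) (X : Set (EuclideanSpace ℝ (Fin N)))
    (g : EuclideanSpace ℝ (Fin N) → EuclideanSpace ℝ (Fin N)) : Prop :=
  ∀ x ∈ X, ∀ v ∈ tangentSet d X x, inner ℝ (g x) v = 0

/-- The level set `u⁻¹(c)` of a function `u` with domain `V`. -/
def levelSet {n : ℕ} (V : Set (EuclideanSpace ℝ (Fin n))) (u : EuclideanSpace ℝ (Fin n) → ℝ)
    (c : ℝ) : Set (EuclideanSpace ℝ (Fin n)) :=
  {x | x ∈ V ∧ u x = c}

/-- `u : V → ℝ` is a normal solution to `∇u = λ g`, where `g : U → ℝ^n ∖ {0}`. Values of `u`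
outside `V` play no role. (If `n = 0` there is no `g` on a nonempty `U`, so the truncated
subtraction `n - 1` is harmless.) -/
structure IsNormalSolution {n : ℕ} (U : Set (EuclideanSpace ℝ (Fin n)))
    (g : EuclideanSpace ℝ (Fin n) → EuclideanSpace ℝ (Fin n))
    (V : Set (EuclideanSpace ℝ (Fin n))) (u : EuclideanSpace ℝ (Fin n) → ℝ) : Prop where
  isOpen : IsOpen V
  subset : V ⊆ U
  lipschitz : RealLipschitzOnCompacts u V
  manifold : ∀ c : ℝ, IsCkManifold (n - 1) 1 (levelSet V u c)
  normal : ∀ c : ℝ, IsNormalField (n - 1) (levelSet V u c) g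
  not_isLocalMax : ∀ x ∈ V, ¬ IsLocalMax u x
  not_isLocalMin : ∀ x ∈ V, ¬ IsLocalMin u x
  gradient_ne_zero : ∀ x ∈ V, DifferentiableAt ℝ u x → gradient u x ≠ 0

/-- On the set `A`, `v` is a monotone transform of `u`: `v = φ ∘ u` on `A` with `φ` strictly
increasing on `u(A)` or strictly decreasing on `u(A)`. -/
def IsMonotoneTransformOn {n : ℕ} (v u : EuclideanSpace ℝ (Fin n) → ℝ)
    (A : Set (EuclideanSpace ℝ (Fin n))) : Prop :=
  ∃ φ : ℝ → ℝ, (StrictMonoOn φ (u '' A) ∨ StrictAntiOn φ (u '' A)) ∧ ∀ x ∈ A, v x = φ (u x)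

/-! Fix a unit vector `e` along `g` at the given point and rescale `g` to `h` with `⟪h, e⟫ = 1`. A
hypersurface normal to `g` is locally a graph over the complement of `e`, so each direction `p ⟂ e`
lifts to a curve in it with velocity `p + β • e`; normality forces `β = -⟪h, p⟫`. Lifted curves thus
solve an ODE that involves `g` but no solution `u`, and `h` being Lipschitz makes them unique. Hence
every normal solution is constant along one and the same curve from `z` to a point of the axis `x +
ℝ e` (`exists_axis_coordinate`). The absence of local extrema makes `u₁` and `u₂` strictly monotone
along the axis (`IsNormalSolution.strictMonoOn_axis`), and inverting one gives `φ`. -/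

open Metric Filter Topology
open scoped NNReal

/-! ### Scalar ODE for the correction along the axis -/

/-- A Picard–Lindelöf solution that stays in the closed ball on which the field is controlled. -/
theorem IsPicardLindelof.exists_mem_closedBall_hasDerivWithinAt {E : Type*}
    [NormedAddCommGroup E] [NormedSpace ℝ E] [CompleteSpace E] {f : ℝ → E → E} {tmin tmax : ℝ}
    {t₀ : Icc tmin tmax} {x₀ x : E} {a r L K : ℝ≥0}
    (hf : IsPicardLindelof f t₀ x₀ a r L K) (hx : x ∈ closedBall x₀ r) :
    ∃ α : ℝ → E, α t₀ = x ∧ ∀ t ∈ Icc tmin tmax, α t ∈ closedBall x₀ a ∧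
      HasDerivWithinAt α (f t (α t)) (Icc tmin tmax) t := by
  obtain ⟨α, hα⟩ := ODE.FunSpace.exists_isFixedPt_next hf hx
  refine ⟨α.compProj, by rw [ODE.FunSpace.compProj_val, ← hα, ODE.FunSpace.next_apply₀],
    fun t ht ↦ ⟨α.compProj_mem_closedBall hf.mul_max_le, ?_⟩⟩
  apply ODE.hasDerivWithinAt_picard_Icc t₀.2 hf.continuousOn_uncurry
    α.continuous_compProj.continuousOn (fun _ ht' ↦ α.compProj_mem_closedBall hf.mul_max_le)
    x ht |>.congr_of_mem _ ht
  intro t' ht'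
  nth_rw 1 [← hα]
  rw [ODE.FunSpace.compProj_of_mem ht', ODE.FunSpace.next_apply]

/-- Points `z + t p` can be corrected along `e` to a curve orthogonal to the field `h`, where
`⟪h, e⟫ = 1`; the correction solves a scalar differential equation. -/
theorem exists_transversal_correction {E : Type*} [NormedAddCommGroup E] [InnerProductSpace ℝ E]
    {h : E → E} {e x p z : E} {R : ℝ} {B K : ℝ≥0} (he : ‖e‖ = 1)
    (hK : LipschitzOnWith K h (ball x R)) (hB : ∀ y ∈ ball x R, ‖h y‖ ≤ B)
    (hz : dist z x + (2 + 2 * B) * ‖p‖ < R) :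
    ∃ b : ℝ → ℝ, b 0 = 0 ∧ ∀ t ∈ Ioo (-2 : ℝ) 2, |b t| ≤ 2 * B * ‖p‖ ∧
      z + t • p + b t • e ∈ ball x R ∧
      HasDerivAt b (-inner ℝ (h (z + t • p + b t • e)) p) t := by
  have hmem : ∀ t ∈ Icc (-2 : ℝ) 2, ∀ s : ℝ, |s| ≤ 2 * B * ‖p‖ →
      z + t • p + s • e ∈ ball x R := by
    intro t ht s hs
    rw [mem_ball, dist_eq_norm]
    have h1 : ‖z + t • p + s • e - x‖ ≤ ‖z - x‖ + |t| * ‖p‖ + |s| := by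
      calc ‖z + t • p + s • e - x‖ = ‖(z - x) + t • p + s • e‖ := by congr 1; abel
        _ ≤ ‖z - x‖ + ‖t • p‖ + ‖s • e‖ := norm_add₃_le
        _ = _ := by rw [norm_smul, norm_smul, he, Real.norm_eq_abs, Real.norm_eq_abs, mul_one]
    have h2 : |t| * ‖p‖ ≤ 2 * ‖p‖ :=
      mul_le_mul_of_nonneg_right (abs_le.2 ht) (norm_nonneg _)
    rw [dist_eq_norm] at hz
    linarith
  -- The slope is at most `B * ‖p‖` and the time at most `2`, whence the radius `2 * B * ‖p‖`. The
  -- interval `[-2, 2]` keeps `0` and `1` interior.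
  have hpl : IsPicardLindelof (fun t s : ℝ ↦ -inner ℝ (h (z + t • p + s • e)) p)
      (⟨0, by norm_num⟩ : Icc (-2 : ℝ) 2) (0 : ℝ) (2 * B * ‖p‖₊) 0 (B * ‖p‖₊) (K * ‖p‖₊) := by
    refine ⟨fun t ht ↦ ?_, fun s hs ↦ ?_, fun t ht s hs ↦ ?_, ?_⟩
    · refine LipschitzOnWith.of_dist_le_mul fun s hs s' hs' ↦ ?_
      have hs : |s| ≤ 2 * B * ‖p‖ := by simpa using hs
      have hs' : |s'| ≤ 2 * B * ‖p‖ := by simpa using hs'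
      have h1 := hK.dist_le_mul _ (hmem t ht s hs) _ (hmem t ht s' hs')
      rw [dist_add_left, dist_eq_norm (s • e), ← sub_smul, norm_smul, he, mul_one,
        dist_eq_norm] at h1
      rw [dist_eq_norm, dist_eq_norm, neg_sub_neg, ← inner_sub_left, norm_sub_rev s s']
      refine (norm_inner_le_norm _ _).trans ?_
      rw [norm_sub_rev s' s, norm_sub_rev]
      push_cast
      calc _ ≤ K * ‖s - s'‖ * ‖p‖ := mul_le_mul_of_nonneg_right h1 (norm_nonneg _)
        _ = _ := by ring
    · have hs : |s| ≤ 2 * B * ‖p‖ := by simpa using hs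
      have : ContinuousOn (fun t : ℝ ↦ h (z + t • p + s • e)) (Icc (-2) 2) :=
        hK.continuousOn.comp (by fun_prop) fun t ht ↦ hmem t ht s hs
      exact (this.inner continuousOn_const).neg
    · have hs : |s| ≤ 2 * B * ‖p‖ := by simpa using hs
      rw [norm_neg]
      refine (norm_inner_le_norm _ _).trans ?_
      push_cast
      exact mul_le_mul_of_nonneg_right (hB _ (hmem t ht s hs)) (norm_nonneg _)
    · push_cast
      norm_num
      linarith
  obtain ⟨b, hb0, hb⟩ := hpl.exists_mem_closedBall_hasDerivWithinAt (mem_closedBall_self le_rfl)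
  refine ⟨b, hb0, fun t ht ↦ ?_⟩
  obtain ⟨hb1, hb2⟩ := hb t (Ioo_subset_Icc_self ht)
  have hb1 : |b t| ≤ 2 * B * ‖p‖ := by simpa using hb1
  exact ⟨hb1, hmem t (Ioo_subset_Icc_self ht) _ hb1, hb2.hasDerivAt (Icc_mem_nhds ht.1 ht.2)⟩

/-! ### One-variable monotonicity and curves in hypersurfaces -/

/-- A continuous function on an interval without local extrema is strictly monotone. -/
theorem ContinuousOn.strictMonoOn_or_strictAntiOn_of_not_isLocalExtr {f : ℝ → ℝ} {a b : ℝ}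
    (hab : a < b) (hf : ContinuousOn f (Ioo a b)) (hext : ∀ c ∈ Ioo a b, ¬ IsLocalExtr f c) :
    StrictMonoOn f (Ioo a b) ∨ StrictAntiOn f (Ioo a b) := by
  refine hf.strictMonoOn_of_injOn_Ioo hab ?_
  have key : ∀ s ∈ Ioo a b, ∀ t ∈ Ioo a b, s < t → f s ≠ f t := by
    intro s hs t ht hst heq
    have hsub : Icc s t ⊆ Ioo a b := Icc_subset_Ioo hs.1 ht.2
    obtain ⟨c, hc, hc'⟩ := exists_isLocalExtr_Ioo hst (hf.mono hsub) heq
    exact hext c (hsub (Ioo_subset_Icc_self hc)) hc'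
  intro s hs t ht heq
  rcases lt_trichotomy s t with h | h | h
  · exact absurd heq (key s hs t ht h)
  · exact h
  · exact absurd heq.symm (key t ht s hs h)

/-- A local parametrization is `C^1` with injective derivative. -/
theorem IsLocalParametrization.contDiffAt_and_injective {d N : ℕ}
    {X : Set (EuclideanSpace ℝ (Fin N))} {x : EuclideanSpace ℝ (Fin N)}
    {W : Set (EuclideanSpace ℝ (Fin d))}
    {φ : EuclideanSpace ℝ (Fin d) → EuclideanSpace ℝ (Fin N)}
    (hφ : IsLocalParametrization 1 X x W φ) {w : EuclideanSpace ℝ (Fin d)} (hw : w ∈ W) :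
    ContDiffAt ℝ 1 φ w ∧ Function.Injective (fderiv ℝ φ w) := by
  obtain ⟨hW, O, hO, hx, hbij, hC, f', hinv, hC'⟩ := hφ
  have h1 : ContDiffAt ℝ 1 φ w := by
    obtain ⟨r, hr, F, hF, hFφ⟩ := hC w hw
    have hF : ContDiffOn ℝ 1 F (ball w r) := by simpa using hF
    refine (hF.contDiffAt (ball_mem_nhds w hr)).congr_of_eventuallyEq ?_
    filter_upwards [hW.mem_nhds hw, ball_mem_nhds w hr] with y hy hy'
    exact (hFφ y ⟨hy, hy'⟩).symm
  refine ⟨h1, ?_⟩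
  obtain ⟨r, hr, F, hF, hFf⟩ := hC' (φ w) (hbij.mapsTo hw)
  have hF : ContDiffOn ℝ 1 F (ball (φ w) r) := by simpa using hF
  have hFd : DifferentiableAt ℝ F (φ w) :=
    (hF.contDiffAt (ball_mem_nhds _ hr)).differentiableAt one_ne_zero
  have hφd : DifferentiableAt ℝ φ w := h1.differentiableAt one_ne_zero
  have hid : F ∘ φ =ᶠ[𝓝 w] id := by
    filter_upwards [hW.mem_nhds hw, h1.continuousAt.preimage_mem_nhds (ball_mem_nhds _ hr)]
      with y hy hy'
    exact (hFf _ ⟨hbij.mapsTo hy, hy'⟩).trans (hinv.1 hy)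
  have hcomp : (fderiv ℝ F (φ w)).comp (fderiv ℝ φ w) = ContinuousLinearMap.id ℝ _ := by
    rw [← fderiv_comp w hFd hφd, hid.fderiv_eq, fderiv_id]
  intro v v' hv
  have := congrArg (fderiv ℝ F (φ w)) hv
  rw [← ContinuousLinearMap.comp_apply, ← ContinuousLinearMap.comp_apply, hcomp] at this
  exact this

/-- In a hypersurface with normal field `g` transversal to `e` at `x`, every direction `p ⟂ e` is
realized by a curve through `x` whose projection along `e` moves with constant velocity `p`. -/
theorem IsNormalField.exists_curve {N d : ℕ} (hN : N = d + 1) {X : Set (EuclideanSpace ℝ (Fin N))}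
    {g : EuclideanSpace ℝ (Fin N) → EuclideanSpace ℝ (Fin N)} (hg : IsNormalField d X g)
    (hX : IsCkManifold d 1 X) {x e p : EuclideanSpace ℝ (Fin N)} (hx : x ∈ X)
    (hge : inner ℝ (g x) e ≠ 0) (hp : inner ℝ e p = 0) (t₀ : ℝ) :
    ∃ c : ℝ → EuclideanSpace ℝ (Fin N), c t₀ = x ∧ ∀ᶠ t in 𝓝 t₀, c t ∈ X ∧
      ∃ β : ℝ, HasDerivAt c (p + β • e) t ∧ inner ℝ (g (c t)) (p + β • e) = 0 := by
  obtain ⟨W, φ, hφ⟩ := hX x hx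
  have hφ' := hφ
  obtain ⟨hW, O, hO, hxO, hdiff⟩ := hφ'
  have hbij := hdiff.1
  obtain ⟨w, hw, rfl⟩ := hbij.surjOn hxO
  -- The same `φ` parametrizes `X` around each `φ w'`, so normality applies on all of `W`.
  have htan : ∀ w' ∈ W, ∀ v, inner ℝ (g (φ w')) (fderiv ℝ φ w' v) = 0 := by
    intro w' hw' v
    have hmem := hbij.mapsTo hw'
    exact hg _ hmem.1 _ ⟨W, φ, ⟨hφ.1, O, hO, hmem, hdiff⟩, w', hw', rfl, v, rfl⟩
  obtain ⟨hφC, hφi⟩ := hφ.contDiffAt_and_injective hw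
  have he : e ≠ 0 := by
    rintro rfl
    simp at hge
  set S := (ℝ ∙ e)ᗮ with hS
  set P : EuclideanSpace ℝ (Fin N) →L[ℝ] S := S.orthogonalProjectionOnto with hP
  have hker : ∀ v, P v = 0 → ∃ β : ℝ, v = β • e := by
    intro v hv
    have : v ∈ (ℝ ∙ e) := by
      rw [← Submodule.orthogonal_orthogonal (ℝ ∙ e)]
      exact (Submodule.orthogonalProjectionOnto_eq_zero_iff).1 hv
    obtain ⟨β, hβ⟩ := Submodule.mem_span_singleton.1 this
    exact ⟨β, hβ.symm⟩
  have hψC : ContDiffAt ℝ 1 (P ∘ φ) w := P.contDiff.contDiffAt.comp w hφC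
  have hψd : HasFDerivAt (P ∘ φ) (P.comp (fderiv ℝ φ w)) w :=
    P.hasFDerivAt.comp w (hφC.differentiableAt one_ne_zero).hasFDerivAt
  -- A tangent vector killed by `P` is a multiple of `e`, and only the zero multiple is orthogonal
  -- to `g`.
  have hinj : Function.Injective (P.comp (fderiv ℝ φ w)) := by
    refine (injective_iff_map_eq_zero _).2 fun v hv ↦ ?_
    obtain ⟨β, hβ⟩ := hker _ hv
    have h0 := htan w hw v
    have hβ : fderiv ℝ φ w v = β • e := hβ
    rw [hβ, inner_smul_right] at h0
    have hβ0 : β = 0 := (mul_eq_zero.1 h0).resolve_right hge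
    rw [hβ0, zero_smul] at hβ
    exact (injective_iff_map_eq_zero _).1 hφi v hβ
  have : Fact (Module.finrank ℝ (EuclideanSpace ℝ (Fin N)) = d + 1) := ⟨by simpa using hN⟩
  have hdim : Module.finrank ℝ (EuclideanSpace ℝ (Fin d)) = Module.finrank ℝ S := by
    rw [hS, Submodule.finrank_orthogonal_span_singleton (n := d) he, finrank_euclideanSpace_fin]
  let A : EuclideanSpace ℝ (Fin d) ≃L[ℝ] S :=
    (LinearEquiv.ofInjectiveOfFinrankEq
      (P.comp (fderiv ℝ φ w)).toLinearMap hinj hdim).toContinuousLinearEquiv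
  have hψA : HasFDerivAt (P ∘ φ) (A : EuclideanSpace ℝ (Fin d) →L[ℝ] S) w := by
    convert hψd using 1
    ext v : 1
    rfl
  set σ := hψC.localInverse hψA one_ne_zero with hσ
  have hσC : ContDiffAt ℝ 1 σ ((P ∘ φ) w) := hψC.to_localInverse hψA one_ne_zero
  have hσw : σ ((P ∘ φ) w) = w := hψC.localInverse_apply_image hψA one_ne_zero
  have hσr : ∀ᶠ q in 𝓝 ((P ∘ φ) w), (P ∘ φ) (σ q) = q :=
    (hψC.hasStrictFDerivAt' hψA one_ne_zero).eventually_right_inverse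
  have hσW : ∀ᶠ q in 𝓝 ((P ∘ φ) w), σ q ∈ W :=
    hσC.continuousAt.eventually (by rw [hσw]; exact hW.mem_nhds hw)
  have hσd : ∀ᶠ q in 𝓝 ((P ∘ φ) w), DifferentiableAt ℝ σ q :=
    (hσC.eventually (by simp)).mono fun q hq ↦ hq.differentiableAt one_ne_zero
  have hpS : p ∈ S := Submodule.mem_orthogonal_singleton_iff_inner_right.2 hp
  let q : ℝ → S := fun t ↦ (P ∘ φ) w + (t - t₀) • (⟨p, hpS⟩ : S)
  have hq0 : q t₀ = (P ∘ φ) w := by simp [q]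
  have hqd : ∀ t, HasDerivAt q ⟨p, hpS⟩ t := fun t ↦ by
    have := (((hasDerivAt_id t).sub_const t₀).smul_const (⟨p, hpS⟩ : S)).const_add ((P ∘ φ) w)
    rwa [one_smul] at this
  have hqt : Tendsto q (𝓝 t₀) (𝓝 ((P ∘ φ) w)) := hq0 ▸ (hqd t₀).continuousAt
  refine ⟨fun t ↦ φ (σ (q t)), by simp only [hq0, hσw], ?_⟩
  filter_upwards [(hqt.eventually hσr).eventually_nhds, hqt.eventually hσW, hqt.eventually hσd]
    with t h1 h2 h3
  refine ⟨(hbij.mapsTo h2).1, ?_⟩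
  have hφd := ((hφ.contDiffAt_and_injective h2).1.differentiableAt one_ne_zero).hasFDerivAt
  have hcd : HasDerivAt (fun t ↦ φ (σ (q t)))
      (fderiv ℝ φ (σ (q t)) (fderiv ℝ σ (q t) ⟨p, hpS⟩)) t :=
    hφd.comp_hasDerivAt t (h3.hasFDerivAt.comp_hasDerivAt t (hqd t))
  set v := fderiv ℝ φ (σ (q t)) (fderiv ℝ σ (q t) ⟨p, hpS⟩) with hv
  -- The curve projects to the straight line `q` throughout a neighborhood of `t`, so the two
  -- derivatives agree.
  have hPv : P v = ⟨p, hpS⟩ :=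
    ((P.hasFDerivAt.comp_hasDerivAt t hcd).congr_of_eventuallyEq
      (h1.mono fun s hs ↦ hs.symm)).unique (hqd t)
  obtain ⟨β, hβ⟩ := hker (v - p) (by
    rw [map_sub, hPv, sub_eq_zero, hP]
    exact (Submodule.orthogonalProjectionOnto_mem_subspace_eq_self (K := S) ⟨p, hpS⟩).symm)
  have hvp : p + β • e = v := by rw [← hβ]; abel
  exact ⟨β, hvp ▸ hcd, hvp ▸ htan _ h2 _⟩

/-! ### Transport of values to the axis -/

/-- The multiple of `g y` whose inner product with `e` is `1`. -/
noncomputable def transversalNormalization {E : Type*} [NormedAddCommGroup E]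
    [InnerProductSpace ℝ E] (g : E → E) (e : E) (y : E) : E :=
  (inner ℝ (g y) e)⁻¹ • g y

/-- A normal solution is constant along curves orthogonal to `g` whose projection along `e` has
constant velocity. -/
theorem IsNormalSolution.eq_along_curve {n : ℕ} {U V : Set (EuclideanSpace ℝ (Fin n))}
    {g : EuclideanSpace ℝ (Fin n) → EuclideanSpace ℝ (Fin n)} {u : EuclideanSpace ℝ (Fin n) → ℝ}
    (hu : IsNormalSolution U g V u) {x e p : EuclideanSpace ℝ (Fin n)} {R : ℝ} {K : ℝ≥0}
    (he : ‖e‖ = 1) (hV : ball x R ⊆ V) (hge : ∀ y ∈ ball x R, inner ℝ (g y) e ≠ 0)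
    (hK : LipschitzOnWith K (transversalNormalization g e) (ball x R)) (hp : inner ℝ e p = 0)
    {γ : ℝ → EuclideanSpace ℝ (Fin n)}
    (hγ : ∀ t ∈ Ioo (-2 : ℝ) 2, γ t ∈ ball x R ∧
      HasDerivAt γ (p - inner ℝ (transversalNormalization g e (γ t)) p • e) t) :
    u (γ 0) = u (γ 1) := by
  -- A unit vector exists only for `n > 0`, so the subtraction does not truncate.
  have hn : n = n - 1 + 1 := by
    rcases n with _ | n
    · rw [Subsingleton.elim e 0, norm_zero] at he
      exact absurd he zero_ne_one
    · rfl
  have hLip : LipschitzOnWith (K * ‖p‖₊)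
      (fun y ↦ p - inner ℝ (transversalNormalization g e y) p • e) (ball x R) := by
    refine LipschitzOnWith.of_dist_le_mul fun y hy y' hy' ↦ ?_
    have h1 := hK.dist_le_mul y hy y' hy'
    rw [dist_eq_norm] at h1
    rw [dist_sub_left, dist_eq_norm, ← sub_smul, ← inner_sub_left, norm_smul, he, mul_one]
    refine (norm_inner_le_norm _ _).trans ?_
    push_cast
    calc _ ≤ K * dist y y' * ‖p‖ := mul_le_mul_of_nonneg_right h1 (norm_nonneg _)
      _ = _ := by ring
  -- No chain rule is available for `u`. Instead, near `t`, `γ` coincides with a curve inside the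
  -- level set through `γ t`, so `u ∘ γ` is locally constant.
  have hloc : ∀ t ∈ Ioo (-2 : ℝ) 2, HasDerivAt (fun s ↦ u (γ s)) 0 t := by
    intro t ht
    obtain ⟨hγt, -⟩ := hγ t ht
    obtain ⟨c, hc0, hc⟩ := (hu.normal (u (γ t))).exists_curve hn (hu.manifold _)
      (x := γ t) ⟨hV hγt, rfl⟩ (hge _ hγt) hp t
    have hcc : ContinuousAt c t := by
      obtain ⟨-, β, hβ, -⟩ := hc.self_of_nhds
      exact hβ.continuousAt
    have hcb : ∀ᶠ s in 𝓝 t, c s ∈ ball x R :=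
      hcc.eventually (by rw [hc0]; exact isOpen_ball.mem_nhds hγt)
    have heq : c =ᶠ[𝓝 t] γ := by
      refine ODE_solution_unique_of_eventually (s := fun _ ↦ ball x R)
        (v := fun _ y ↦ p - inner ℝ (transversalNormalization g e y) p • e)
        (Eventually.of_forall fun _ ↦ hLip) ?_ ?_ hc0
      · filter_upwards [hc, hcb] with s ⟨_, β, hβ, hβ'⟩ hs
        have hne := hge _ hs
        rw [inner_add_right, inner_smul_right] at hβ'
        have hval : β = -inner ℝ (transversalNormalization g e (c s)) p := by
          rw [transversalNormalization, real_inner_smul_left]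
          field_simp
          linarith
        rw [hval, neg_smul, ← sub_eq_add_neg] at hβ
        exact ⟨hβ, hs⟩
      · filter_upwards [isOpen_Ioo.mem_nhds ht] with s hs
        exact ⟨(hγ s hs).2, (hγ s hs).1⟩
    refine (hasDerivAt_const t (u (γ t))).congr_of_eventuallyEq ?_
    filter_upwards [heq, hc] with s hs hs'
    rw [← hs]
    exact hs'.1.2
  exact isOpen_Ioo.is_const_of_deriv_eq_zero isPreconnected_Ioo
    (fun t ht ↦ (hloc t ht).differentiableAt.differentiableWithinAt)
    (fun t ht ↦ (hloc t ht).deriv) (by norm_num) (by norm_num)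

/-- Near `x`, all normal solutions take at `z` their value at one common point `x + s e` of the
axis through `x`, and `s` is controlled by the distance of `z` to the axis points. -/
theorem exists_axis_coordinate {n : ℕ} {U : Set (EuclideanSpace ℝ (Fin n))}
    {g : EuclideanSpace ℝ (Fin n) → EuclideanSpace ℝ (Fin n)}
    {x e : EuclideanSpace ℝ (Fin n)} {R : ℝ} {B K : ℝ≥0}
    (he : ‖e‖ = 1) (hge : ∀ y ∈ ball x R, inner ℝ (g y) e ≠ 0)
    (hK : LipschitzOnWith K (transversalNormalization g e) (ball x R))
    (hB : ∀ y ∈ ball x R, ‖transversalNormalization g e y‖ ≤ B)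
    {z : EuclideanSpace ℝ (Fin n)} (hz : (3 + 2 * B) * dist z x < R) :
    ∃ s : ℝ, (∀ s₀ : ℝ, |s - s₀| ≤ (2 * B + 1) * dist z (x + s₀ • e)) ∧
      ∀ V u, IsNormalSolution U g V u → ball x R ⊆ V → u z = u (x + s • e) := by
  -- With these choices `z + p = x + a • e`, so the corrected curve meets the axis at time `1`, at
  -- coordinate `b 1 + a`.
  set a : ℝ := inner ℝ e (z - x) with ha
  set p : EuclideanSpace ℝ (Fin n) := a • e - (z - x) with hp
  have hee : inner ℝ e e = (1 : ℝ) := by rw [real_inner_self_eq_norm_sq, he, one_pow]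
  have hpe : inner ℝ e p = (0 : ℝ) := by
    rw [hp, inner_sub_right, inner_smul_right, hee, mul_one, sub_self]
  have hpn : ∀ s₀ : ℝ, ‖p‖ ≤ dist z (x + s₀ • e) := by
    intro s₀
    have h1 : z - (x + s₀ • e) = (a - s₀) • e - p := by rw [hp, sub_smul]; abel
    rw [dist_eq_norm z, h1]
    have h2 : ‖(a - s₀) • e - p‖ ^ 2 = ‖(a - s₀) • e‖ ^ 2 + ‖p‖ ^ 2 := by
      rw [norm_sub_sq_real ((a - s₀) • e) p, inner_smul_left, hpe]
      ring
    refine (sq_le_sq₀ (norm_nonneg _) (norm_nonneg _)).1 ?_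
    rw [h2]
    exact le_add_of_nonneg_left (sq_nonneg _)
  have hpn0 : ‖p‖ ≤ dist z x := by simpa using hpn 0
  obtain ⟨b, hb0, hb⟩ := exists_transversal_correction (p := p) (z := z) he hK hB (by
    have : (2 + 2 * (B : ℝ)) * ‖p‖ ≤ (2 + 2 * B) * dist z x :=
      mul_le_mul_of_nonneg_left hpn0 (by positivity)
    linarith)
  refine ⟨b 1 + a, fun s₀ ↦ ?_, fun V u hu hV ↦ ?_⟩
  · have h1 := (hb 1 (by norm_num)).1
    have h2 : |a - s₀| ≤ dist z (x + s₀ • e) := by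
      have : a - s₀ = inner ℝ e (z - (x + s₀ • e)) := by
        rw [← sub_sub, inner_sub_right, inner_smul_right, hee, mul_one]
      rw [this, dist_eq_norm]
      simpa [he] using abs_real_inner_le_norm e (z - (x + s₀ • e))
    calc |b 1 + a - s₀| ≤ |b 1| + |a - s₀| := by rw [add_sub_assoc]; exact abs_add_le _ _
      _ ≤ 2 * B * dist z (x + s₀ • e) + dist z (x + s₀ • e) :=
        add_le_add (h1.trans (mul_le_mul_of_nonneg_left (hpn s₀) (by positivity))) h2
      _ = _ := by ring
  · have := hu.eq_along_curve he hV hge hK hpe (γ := fun t ↦ z + t • p + b t • e) (by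
      intro t ht
      obtain ⟨-, h2, h3⟩ := hb t ht
      refine ⟨h2, ?_⟩
      have := (((hasDerivAt_id t).smul_const p).const_add z).add (h3.smul_const e)
      rwa [one_smul, neg_smul, ← sub_eq_add_neg] at this)
    have h1 : z + (1 : ℝ) • p + b 1 • e = x + (b 1 + a) • e := by
      rw [one_smul, hp, add_smul]; abel
    simpa only [h1, hb0, zero_smul, add_zero] using this

/-! ### Choice of the axis and monotonicity along it -/

/-- Local data around a point: a unit axis along which the rescaled field is Lipschitz and
bounded. -/
theorem exists_transversal_axis {n : ℕ} {U : Set (EuclideanSpace ℝ (Fin n))} (hU : IsOpen U)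
    {g : EuclideanSpace ℝ (Fin n) → EuclideanSpace ℝ (Fin n)} (hg : LipschitzOnCompacts g U)
    {x : EuclideanSpace ℝ (Fin n)} (hx : x ∈ U) (hgx : g x ≠ 0) :
    ∃ (e : EuclideanSpace ℝ (Fin n)) (B K : ℝ≥0), ‖e‖ = 1 ∧ ∀ᶠ R in 𝓝[>] (0 : ℝ),
      (∀ y ∈ ball x R, inner ℝ (g y) e ≠ 0) ∧
      LipschitzOnWith K (transversalNormalization g e) (ball x R) ∧
      ∀ y ∈ ball x R, ‖transversalNormalization g e y‖ ≤ B := by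
  obtain ⟨r, hr, hrU⟩ := nhds_basis_closedBall.mem_iff.1 (hU.mem_nhds hx)
  obtain ⟨L, hL⟩ := hg _ hrU (isCompact_closedBall x r)
  have hgc : ContinuousAt g x := hL.continuousOn.continuousAt (closedBall_mem_nhds x hr)
  set e : EuclideanSpace ℝ (Fin n) := ‖g x‖⁻¹ • g x with he
  have hne : ‖g x‖ ≠ 0 := norm_ne_zero_iff.2 hgx
  have hge : inner ℝ (g x) e ≠ 0 := by
    rw [he, inner_smul_right, real_inner_self_eq_norm_sq]
    positivity
  -- The rescaling `v ↦ v / ⟪v, e⟫` is `C^1` near `g x`, so composing it with the Lipschitz `g`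
  -- stays Lipschitz.
  have hG : ContDiffAt ℝ 1 (fun v : EuclideanSpace ℝ (Fin n) ↦ (inner ℝ v e)⁻¹ • v) (g x) :=
    ((contDiffAt_id.inner ℝ contDiffAt_const).inv hge).smul contDiffAt_id
  obtain ⟨K, T, hT, hK⟩ := (hG.hasStrictFDerivAt one_ne_zero).exists_lipschitzOnWith
  have hc : ContinuousAt (transversalNormalization g e) x :=
    ContinuousAt.comp (g := fun v : EuclideanSpace ℝ (Fin n) ↦ (inner ℝ v e)⁻¹ • v)
      hG.continuousAt hgc
  refine ⟨e, ‖transversalNormalization g e x‖₊ + 1, K * L, ?_, ?_⟩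
  · rw [he, norm_smul, norm_inv, norm_norm, inv_mul_cancel₀ hne]
  have h1 : ∀ᶠ y in 𝓝 x, inner ℝ (g y) e ≠ 0 :=
    (hgc.inner continuousAt_const).eventually_ne hge
  have h2 : ∀ᶠ y in 𝓝 x, ‖transversalNormalization g e y‖ <
      ‖transversalNormalization g e x‖ + 1 :=
    hc.norm.eventually_lt_const (lt_add_one _)
  have h3 : ∀ᶠ y in 𝓝 x, g y ∈ T := hgc.eventually hT
  obtain ⟨ρ, hρ, hball⟩ := nhds_basis_ball.mem_iff.1
    (h1.and (h2.and (h3.and (closedBall_mem_nhds x hr))))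
  filter_upwards [Ioo_mem_nhdsGT hρ] with R hR
  have hsub := fun y (hy : y ∈ ball x R) ↦ hball (ball_subset_ball hR.2.le hy)
  refine ⟨fun y hy ↦ (hsub y hy).1, ?_, fun y hy ↦ by simpa using (hsub y hy).2.1.le⟩
  exact hK.comp (hL.mono fun y hy ↦ (hsub y hy).2.2.2) fun y hy ↦ (hsub y hy).2.2.1

theorem IsNormalSolution.continuousOn {n : ℕ} {U V : Set (EuclideanSpace ℝ (Fin n))}
    {g : EuclideanSpace ℝ (Fin n) → EuclideanSpace ℝ (Fin n)} {u : EuclideanSpace ℝ (Fin n) → ℝ}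
    (hu : IsNormalSolution U g V u) : ContinuousOn u V := by
  intro x hx
  obtain ⟨r, hr, hrV⟩ := nhds_basis_closedBall.mem_iff.1 (hu.isOpen.mem_nhds hx)
  obtain ⟨L, hL⟩ := hu.lipschitz _ hrV (isCompact_closedBall x r)
  exact (hL.continuousOn.continuousAt (closedBall_mem_nhds x hr)).continuousWithinAt

/-- A normal solution that near `x` depends only on an axis coordinate is strictly monotone along
the axis. -/
theorem IsNormalSolution.strictMonoOn_axis {n : ℕ} {U V : Set (EuclideanSpace ℝ (Fin n))}
    {g : EuclideanSpace ℝ (Fin n) → EuclideanSpace ℝ (Fin n)} {u : EuclideanSpace ℝ (Fin n) → ℝ}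
    (hu : IsNormalSolution U g V u) {x e : EuclideanSpace ℝ (Fin n)} {δ C : ℝ} (hδ : 0 < δ)
    (he : ‖e‖ = 1) (hV : ball x δ ⊆ V)
    (haxis : ∀ z ∈ ball x δ, ∃ s : ℝ, (∀ s₀ : ℝ, |s - s₀| ≤ C * dist z (x + s₀ • e)) ∧
      u z = u (x + s • e)) :
    StrictMonoOn (fun s : ℝ ↦ u (x + s • e)) (Ioo (-δ) δ) ∨
      StrictAntiOn (fun s : ℝ ↦ u (x + s • e)) (Ioo (-δ) δ) := by
  have hmem : ∀ s ∈ Ioo (-δ) δ, x + s • e ∈ ball x δ := by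
    intro s hs
    rw [mem_ball, dist_self_add_left, norm_smul, he, mul_one]
    exact abs_lt.2 hs
  refine ContinuousOn.strictMonoOn_or_strictAntiOn_of_not_isLocalExtr (by linarith)
    ((hu.continuousOn.mono hV).comp (by fun_prop) hmem) fun s₀ hs₀ hext ↦ ?_
  -- The axis coordinate of `z` tends to `s₀` as `z → x + s₀ • e`, so an extremum along the axis is
  -- one in the whole space.
  have key : ∀ Q : ℝ → Prop, (∀ᶠ s in 𝓝 s₀, Q (u (x + s • e))) →
      ∀ᶠ z in 𝓝 (x + s₀ • e), Q (u z) := by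
    intro Q hQ
    have hex : ∀ z, ∃ s : ℝ, z ∈ ball x δ → (∀ s₀ : ℝ, |s - s₀| ≤ C * dist z (x + s₀ • e)) ∧
        u z = u (x + s • e) := fun z ↦ by
      by_cases hz : z ∈ ball x δ
      · exact (haxis z hz).imp fun s hs _ ↦ hs
      · exact ⟨0, fun h ↦ absurd h hz⟩
    choose σ hσ using hex
    have hball := isOpen_ball.mem_nhds (hmem s₀ hs₀)
    have hlim : Tendsto σ (𝓝 (x + s₀ • e)) (𝓝 s₀) := by
      rw [tendsto_iff_dist_tendsto_zero]
      have hd : Tendsto (fun z ↦ C * dist z (x + s₀ • e)) (𝓝 (x + s₀ • e)) (𝓝 0) := by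
        have : Continuous fun z ↦ C * dist z (x + s₀ • e) := by fun_prop
        simpa using this.tendsto (x + s₀ • e)
      refine squeeze_zero' (Eventually.of_forall fun _ ↦ dist_nonneg) ?_ hd
      filter_upwards [hball] with z hz
      exact (hσ z hz).1 s₀
    filter_upwards [hlim.eventually hQ, hball] with z hz hz'
    rwa [(hσ z hz').2]
  rcases hext with h | h
  · exact hu.not_isLocalMin _ (hV (hmem s₀ hs₀)) (key (u (x + s₀ • e) ≤ ·) h)
  · exact hu.not_isLocalMax _ (hV (hmem s₀ hs₀)) (key (· ≤ u (x + s₀ • e)) h)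

/-! ### The monotone transform -/

theorem strictMonoOn_or_strictAntiOn_comp_invFunOn {f₁ f₂ : ℝ → ℝ} {I : Set ℝ}
    (h₁ : StrictMonoOn f₁ I ∨ StrictAntiOn f₁ I) (h₂ : StrictMonoOn f₂ I ∨ StrictAntiOn f₂ I) :
    StrictMonoOn (f₂ ∘ Function.invFunOn f₁ I) (f₁ '' I) ∨
      StrictAntiOn (f₂ ∘ Function.invFunOn f₁ I) (f₁ '' I) := by
  have hinj : InjOn f₁ I := h₁.elim StrictMonoOn.injOn StrictAntiOn.injOn
  have hmaps : MapsTo (Function.invFunOn f₁ I) (f₁ '' I) I :=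
    fun y hy ↦ Function.invFunOn_mem hy
  have hinv : StrictMonoOn (Function.invFunOn f₁ I) (f₁ '' I) ∨
      StrictAntiOn (Function.invFunOn f₁ I) (f₁ '' I) := by
    refine h₁.imp (fun h ↦ ?_) fun h ↦ ?_ <;>
    · rintro _ ⟨s, hs, rfl⟩ _ ⟨t, ht, rfl⟩ hst
      rw [hinj.leftInvOn_invFunOn hs, hinj.leftInvOn_invFunOn ht]
      first
        | exact (h.lt_iff_lt hs ht).1 hst
        | exact (h.lt_iff_gt hs ht).1 hst
  rcases h₂ with h₂ | h₂ <;> rcases hinv with hinv | hinv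
  · exact .inl (h₂.comp hinv hmaps)
  · exact .inr (h₂.comp_strictAntiOn hinv hmaps)
  · exact .inr (h₂.comp_strictMonoOn hinv hmaps)
  · exact .inl (h₂.comp hinv hmaps)

theorem mainTheorem5 {n : ℕ} (U : Set (EuclideanSpace ℝ (Fin n))) (hU : IsOpen U)
    (g : EuclideanSpace ℝ (Fin n) → EuclideanSpace ℝ (Fin n))
    (hg0 : ∀ x ∈ U, g x ≠ 0) (hg : LipschitzOnCompacts g U)
    (V₁ V₂ : Set (EuclideanSpace ℝ (Fin n))) (u₁ u₂ : EuclideanSpace ℝ (Fin n) → ℝ)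
    (h₁ : IsNormalSolution U g V₁ u₁) (h₂ : IsNormalSolution U g V₂ u₂)
    (xs : EuclideanSpace ℝ (Fin n)) (hx₁ : xs ∈ V₁) (hx₂ : xs ∈ V₂) :
    ∃ V₃ : Set (EuclideanSpace ℝ (Fin n)), IsOpen V₃ ∧ xs ∈ V₃ ∧ V₃ ⊆ V₁ ∩ V₂ ∧
      IsMonotoneTransformOn u₂ u₁ V₃ ∧
      levelSet V₁ u₁ (u₁ xs) ∩ V₃ = levelSet V₂ u₂ (u₂ xs) ∩ V₃ := by
  have hxU := h₁.subset hx₁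
  obtain ⟨e, B, K, he, hev⟩ := exists_transversal_axis hU hg hxU (hg0 xs hxU)
  obtain ⟨ρ, hρ, hρV⟩ := nhds_basis_ball.mem_iff.1
    ((h₁.isOpen.inter h₂.isOpen).mem_nhds ⟨hx₁, hx₂⟩)
  obtain ⟨R, ⟨hge, hK, hB⟩, hR⟩ := (hev.and (Ioo_mem_nhdsGT hρ)).exists
  have hR0 : 0 < R := hR.1
  have hRV : ball xs R ⊆ V₁ ∩ V₂ := (ball_subset_ball hR.2.le).trans hρV
  set δ : ℝ := R / (3 + 2 * B) with hδ
  have hδ0 : 0 < δ := by positivity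
  have hδR : δ ≤ R := div_le_self hR0.le (by linarith [B.coe_nonneg])
  set C : ℝ := 2 * B + 1 with hC
  have hC1 : 1 ≤ C := by simp [hC]
  have haxis : ∀ z ∈ ball xs δ, ∃ s : ℝ, (∀ s₀ : ℝ, |s - s₀| ≤ C * dist z (xs + s₀ • e)) ∧
      u₁ z = u₁ (xs + s • e) ∧ u₂ z = u₂ (xs + s • e) := by
    intro z hz
    obtain ⟨s, hs, hs'⟩ := exists_axis_coordinate (U := U) he hge hK hB (z := z) (by
      rw [mul_comm]; exact (lt_div_iff₀ (by positivity)).1 hz)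
    exact ⟨s, hs, hs' V₁ u₁ h₁ fun y hy ↦ (hRV hy).1, hs' V₂ u₂ h₂ fun y hy ↦ (hRV hy).2⟩
  have hδV := (ball_subset_ball hδR).trans hRV
  have hm₁ := h₁.strictMonoOn_axis hδ0 he (fun y hy ↦ (hδV hy).1)
    fun z hz ↦ (haxis z hz).imp fun s hs ↦ ⟨hs.1, hs.2.1⟩
  have hm₂ := h₂.strictMonoOn_axis hδ0 he (fun y hy ↦ (hδV hy).2)
    fun z hz ↦ (haxis z hz).imp fun s hs ↦ ⟨hs.1, hs.2.2⟩
  set f₁ : ℝ → ℝ := fun s ↦ u₁ (xs + s • e) with hf₁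
  set f₂ : ℝ → ℝ := fun s ↦ u₂ (xs + s • e) with hf₂
  have hi₁ : InjOn f₁ (Ioo (-δ) δ) := hm₁.elim StrictMonoOn.injOn StrictAntiOn.injOn
  have hi₂ : InjOn f₂ (Ioo (-δ) δ) := hm₂.elim StrictMonoOn.injOn StrictAntiOn.injOn
  -- Taking `s₀ = 0` gives `|s| ≤ C * dist z xs`, so this smaller ball keeps coordinates in `(-δ,
  -- δ)`.
  have hsub : ball xs (δ / C) ⊆ ball xs δ := ball_subset_ball (div_le_self hδ0.le hC1)
  have hcoord : ∀ z ∈ ball xs (δ / C), ∃ s ∈ Ioo (-δ) δ, u₁ z = f₁ s ∧ u₂ z = f₂ s := by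
    intro z hz
    obtain ⟨s, hs, hs'⟩ := haxis z (hsub hz)
    have h0 : |s| ≤ C * dist z xs := by simpa using hs 0
    have hz' : C * dist z xs < δ := by
      rw [mul_comm]; exact (lt_div_iff₀ (by positivity)).1 hz
    exact ⟨s, abs_lt.1 (h0.trans_lt hz'), hs'⟩
  have himg : u₁ '' ball xs (δ / C) ⊆ f₁ '' Ioo (-δ) δ := by
    rintro _ ⟨z, hz, rfl⟩
    obtain ⟨s, hs, hs', -⟩ := hcoord z hz
    exact ⟨s, hs, hs'.symm⟩
  refine ⟨ball xs (δ / C), isOpen_ball, mem_ball_self (by positivity), hsub.trans hδV,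
    ⟨f₂ ∘ Function.invFunOn f₁ (Ioo (-δ) δ),
      (strictMonoOn_or_strictAntiOn_comp_invFunOn hm₁ hm₂).imp (·.mono himg) (·.mono himg),
      fun z hz ↦ ?_⟩, ?_⟩
  · obtain ⟨s, hs, hs₁, hs₂⟩ := hcoord z hz
    rw [hs₁, hs₂, Function.comp_apply, hi₁.leftInvOn_invFunOn hs]
  · ext z
    -- By injectivity along the axis, both level sets are the points with `s = 0`.
    refine and_congr_left fun hz ↦ ?_
    obtain ⟨s, hs, hs₁, hs₂⟩ := hcoord z hz
    have h0 : (0 : ℝ) ∈ Ioo (-δ) δ := ⟨by linarith, hδ0⟩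
    have e₁ : u₁ xs = f₁ 0 := by simp [hf₁]
    have e₂ : u₂ xs = f₂ 0 := by simp [hf₂]
    have hzV := hδV (hsub hz)
    simp only [levelSet, mem_ofPred_eq, hzV.1, hzV.2, true_and, hs₁, hs₂, e₁, e₂,
      hi₁.eq_iff hs h0, hi₂.eq_iff hs h0]
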